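/- Let $I=[a,b]$ with $a\le b$, let $d\in\mathbb N$, let $\Gamma_I=C^0(I;\mathbb R^d)$ with the uniform norm and $\mathrm{ev}_t(\gamma)=\gamma(t)$. For a separable metric space $X$ let $\mathcal P(X)$ be the set of Borel probability measures on $X$ with the topology of narrow convergence (convergence against bounded continuous functions). Let $L: I\times\mathbb R^d\times\mathbb R^d\times\mathcal P(\mathbb R^d)\to[0,+\infty]$ be a Borel function such that $L(t,\cdot,\cdot,\cdot)$ is sequentially lower semicontinuous for a.e. $t\in I$, $L(\cdot,x,z,\mu)$ is Lebesgue measurable for all $(x,z,\mu)$, and $L(t,x,\cdot,\mu)$ is convex for all $(t,x,\mu)$. Let $G:\mathbb R^d\times\mathcal P(\mathbb R^d)\to[0,+\infty]$ be a sequentially lower semicontinuous Borel function, and let $\psi,\phi:[0,1]\to[0,+\infty]$ be lower semicontinuous and non-increasing. For $\eta\in\mathcal P(\Gamma_I)$, $t\in I$, $y\in\mathbb R^d$ let $m_t(y;\eta)=\eta(\{\gamma\in\Gamma_I:\gamma(t)=y\})$ be the multiplicity of $\eta$ at $y$ at time $t$, and define, with the convention $0\cdot\infty=0$, $$\mathcal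 L_\psi(\eta)=\int_{\Gamma_I}\int_I \psi\big(m_t(\gamma(t);\eta)\big)\,L\big(t,\gamma(t),\dot\gamma(t),(\mathrm{ev}_t)_\sharp\eta\big)\,dt\,d\eta(\gamma),$$ $$\mathcal G_\phi(\eta)=\int_{\Gamma_I}\phi\big(m_b(\gamma(b);\eta)\big)\,G\big(\gamma(b),(\mathrm{ev}_b)_\sharp\eta\big)\,d\eta(\gamma),\qquad \mathcal E_{\psi,\phi}=\mathcal L_\psi+\mathcal G_\phi,$$ where $\dot\gamma(t)$ is the derivative of $\gamma$ at $t$ if it exists and $0$ otherwise. Let $q\in[1,+\infty)$, and let $W^{1,q}(I;\mathbb R^d)\subseteq\Gamma_I$ be the space of absolutely continuous curves with derivative in $L^q(I;\mathbb R^d)$, with its norm topology, given by the norm $\max(\|\gamma\|_\infty,\|\dot\gamma\|_{L^q})$ (for $a<b$ equivalent to $\|\gamma\|_{L^q}+\|\dot\gamma\|_{L^q}$). A measure $\eta\in\mathcal P(W^{1,q}(I;\mathbb R^d))$ is regarded as an element of $\mathcal P(\Gamma_I)$ through the inclusion $W^{1,q}(I;\mathbb R^d)\subseteq\Gamma_I$.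 Then $\mathcal E_{\psi,\phi}:\mathcal P(W^{1,q}(I;\mathbb R^d))\to[0,+\infty]$ is sequentially lower semicontinuous with respect to narrow convergence: if $\eta_n\to\eta$ narrowly in $\mathcal P(W^{1,q}(I;\mathbb R^d))$, then $\mathcal E_{\psi,\phi}(\eta)\le\liminf_{n\to\infty}\mathcal E_{\psi,\phi}(\eta_n)$. -/

import Mathlib

open Set Filter Topology MeasureTheory
open scoped ENNReal NNReal unitInterval

noncomputable section

/-- Sequential lower semicontinuity of a `[0, ∞]`-valued function. -/
def SeqLSC {X : Type*} [TopologicalSpace X] (f : X → ℝ≥0∞) : Prop :=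
  ∀ (u : ℕ → X) (x : X), Tendsto u atTop (𝓝 x) →
    f x ≤ liminf (fun n => f (u n)) atTop

/-- Borel functions between topological spaces. -/
def IsBorelFun {X Y : Type*} [TopologicalSpace X] [TopologicalSpace Y] (f : X → Y) : Prop :=
  Measurable[borel X, borel Y] f

/-- `ℝ^d` with the Euclidean norm. -/
abbrev Eucl (d : ℕ) : Type := EuclideanSpace ℝ (Fin d)

/-- The space of continuous curves `Γ_I = C⁰(I; ℝ^d)`, `I = [a, b]`, with the uniform distance. -/
abbrev PathSpace (a b : ℝ) (d : ℕ) : Type := C(Icc a b, Eucl d)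

instance pathMeasurableSpace (a b : ℝ) (d : ℕ) : MeasurableSpace (PathSpace a b d) := borel _

instance pathBorelSpace (a b : ℝ) (d : ℕ) : BorelSpace (PathSpace a b d) := ⟨rfl⟩

/-- The Lebesgue measure on `I = [a, b]`. -/
def leb (a b : ℝ) : Measure (Icc a b) := (volume : Measure ℝ).comap Subtype.val

variable {a b : ℝ} {d : ℕ}

/-- The evaluation map `ev_t` is measurable. -/
theorem measurable_ev (t : Icc a b) : Measurable (fun γ : PathSpace a b d => γ t) :=
  (continuous_eval_const t).measurable

/-- A curve on `I = [a, b]` seen as a function on `ℝ` (with value `0` outside `I`). Only its values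
on `I` are ever used. -/
def onReal (γ : PathSpace a b d) : ℝ → Eucl d :=
  Function.extend Subtype.val γ 0

/-- The derivative `ev̇_t(γ)`: the limit of `(γ(s) - γ(t)) / (s - t)` as `s → t`, `s ∈ I`, if `γ` is
differentiable at `t`, and `0` otherwise. -/
def evDot (t : Icc a b) (γ : PathSpace a b d) : Eucl d :=
  derivWithin (onReal γ) (Icc a b) t

/-- The marginal `(ev_t)_# η` of `η ∈ P(Γ_I)`. -/
def marginal (t : Icc a b) (η : ProbabilityMeasure (PathSpace a b d)) :
    ProbabilityMeasure (Eucl d) :=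
  η.map (measurable_ev t).aemeasurable

/-- The multiplicity `η({γ ∈ Γ_I : γ(t) = y}) ∈ [0, 1]` of `η` at the point `y` at time `t`. -/
def multAt (t : Icc a b) (y : Eucl d) (η : ProbabilityMeasure (PathSpace a b d)) : I :=
  ⟨(η : Measure (PathSpace a b d)).real {γ | γ t = y}, measureReal_nonneg, measureReal_le_one⟩

/-- The hypotheses on a Lagrangian `L : I × ℝ^d × ℝ^d × P(ℝ^d) → [0, ∞]`. -/
structure IsLagrangian (L : Icc a b → Eucl d → Eucl d → ProbabilityMeasure (Eucl d) → ℝ≥0∞) :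
    Prop where
  borel : IsBorelFun
    (fun p : Icc a b × Eucl d × Eucl d × ProbabilityMeasure (Eucl d) =>
      L p.1 p.2.1 p.2.2.1 p.2.2.2)
  lsc : ∀ᵐ t ∂(leb a b), SeqLSC
    (fun p : Eucl d × Eucl d × ProbabilityMeasure (Eucl d) => L t p.1 p.2.1 p.2.2)
  lebesgue : ∀ x z μ, NullMeasurable (fun t : Icc a b => L t x z μ) (leb a b)
  convex : ∀ t x μ, ConvexOn ℝ≥0 univ (fun z => L t x z μ)

/-- The hypotheses on a terminal cost `G : ℝ^d × P(ℝ^d) → [0, ∞]`. -/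
structure IsTerminalCost (G : Eucl d → ProbabilityMeasure (Eucl d) → ℝ≥0∞) : Prop where
  borel : IsBorelFun (fun p : Eucl d × ProbabilityMeasure (Eucl d) => G p.1 p.2)
  lsc : SeqLSC (fun p : Eucl d × ProbabilityMeasure (Eucl d) => G p.1 p.2)

/-- The hypotheses on a weight `[0, 1] → [0, ∞]`: lower semicontinuous and non-increasing. -/
structure IsWeight (ψ : I → ℝ≥0∞) : Prop where
  lsc : LowerSemicontinuous ψ
  anti : Antitone ψ

/-- The functional `L_ψ` on `P(Γ_I)` (products in `[0, ∞]` use `0 · ∞ = 0`). -/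
def runningCost (ψ : I → ℝ≥0∞)
    (L : Icc a b → Eucl d → Eucl d → ProbabilityMeasure (Eucl d) → ℝ≥0∞)
    (η : ProbabilityMeasure (PathSpace a b d)) : ℝ≥0∞ :=
  ∫⁻ γ : PathSpace a b d, (∫⁻ t : Icc a b,
    ψ (multAt t (γ t) η) * L t (γ t) (evDot t γ) (marginal t η) ∂(leb a b)) ∂(η : Measure _)

/-- The functional `G_φ` on `P(Γ_I)`. -/
def terminalCost (hab : a ≤ b) (φ : I → ℝ≥0∞)
    (G : Eucl d → ProbabilityMeasure (Eucl d) → ℝ≥0∞)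
    (η : ProbabilityMeasure (PathSpace a b d)) : ℝ≥0∞ :=
  ∫⁻ γ : PathSpace a b d,
    φ (multAt ⟨b, right_mem_Icc.2 hab⟩ (γ ⟨b, right_mem_Icc.2 hab⟩) η) *
      G (γ ⟨b, right_mem_Icc.2 hab⟩) (marginal ⟨b, right_mem_Icc.2 hab⟩ η) ∂(η : Measure _)

/-- The functional `E_{ψ,φ} = L_ψ + G_φ` on `P(Γ_I)`. -/
def totalCost (hab : a ≤ b) (ψ φ : I → ℝ≥0∞)
    (L : Icc a b → Eucl d → Eucl d → ProbabilityMeasure (Eucl d) → ℝ≥0∞)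
    (G : Eucl d → ProbabilityMeasure (Eucl d) → ℝ≥0∞)
    (η : ProbabilityMeasure (PathSpace a b d)) : ℝ≥0∞ :=
  runningCost ψ L η + terminalCost hab φ G η

/-- The Sobolev space `W^{1,q}(I; ℝ^d)`, `I = [a, b]`: the absolutely continuous curves whose
derivative belongs to `L^q(I; ℝ^d)`. -/
def SobolevPath (a b : ℝ) (d : ℕ) (q : ℝ≥0∞) : Type :=
  {γ : PathSpace a b d //
    AbsolutelyContinuousOnInterval (onReal γ) a b ∧ MemLp (fun t => evDot t γ) q (leb a b)}

namespace SobolevPath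

variable {q : ℝ≥0∞}

/-- The inclusion `W^{1,q}(I; ℝ^d) ⊆ Γ_I`. -/
def toPath (γ : SobolevPath a b d q) : PathSpace a b d := γ.1

/-- The derivative, as an element of `L^q(I; ℝ^d)`. -/
def derivLp (γ : SobolevPath a b d q) : Lp (Eucl d) q (leb a b) :=
  γ.2.2.toLp

/-- The map `γ ↦ (γ, γ̇)` into `Γ_I × L^q(I; ℝ^d)`. -/
def graphMap (γ : SobolevPath a b d q) :
    PathSpace a b d × Lp (Eucl d) q (leb a b) :=
  (γ.toPath, γ.derivLp)

theorem graphMap_injective : Function.Injective (graphMap (a := a) (b := b) (d := d) (q := q)) :=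
  fun _ _ h => Subtype.ext (congrArg Prod.fst h)

/-- The norm distance of `W^{1,q}(I; ℝ^d)`, in the form
`max (‖γ₁ - γ₂‖_∞) (‖γ̇₁ - γ̇₂‖_{L^q})`. For `a < b` this norm is equivalent to
`‖γ‖_{L^q} + ‖γ̇‖_{L^q}`, by the continuity of the inclusion of `W^{1,q}` in `C⁰`; for `a = b` it is
the norm of `ℝ^d`. -/
instance instMetricSpace [Fact (1 ≤ q)] : MetricSpace (SobolevPath a b d q) :=
  MetricSpace.induced graphMap graphMap_injective inferInstance

instance instMeasurableSpace [Fact (1 ≤ q)] : MeasurableSpace (SobolevPath a b d q) := borel _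

instance instBorelSpace [Fact (1 ≤ q)] : BorelSpace (SobolevPath a b d q) := ⟨rfl⟩

theorem measurable_toPath [Fact (1 ≤ q)] :
    Measurable (toPath : SobolevPath a b d q → PathSpace a b d) :=
  (continuous_fst.comp (continuous_induced_dom (f := graphMap))).measurable

/-- The measure on `Γ_I` carried by `W^{1,q}(I; ℝ^d)` that `η ∈ P(W^{1,q}(I; ℝ^d))` defines. -/
def lawOnPaths [Fact (1 ≤ q)] (η : ProbabilityMeasure (SobolevPath a b d q)) :
    ProbabilityMeasure (PathSpace a b d) :=
  η.map measurable_toPath.aemeasurable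

end SobolevPath

end

/-!
The heart of the matter is a version of Fatou's lemma in which both the measures and the integrands
move. If `ηₙ → η` narrowly and `f x ≤ liminf Fₙ(xₙ)` whenever `xₙ → x`, then the envelopes `Eₖ`
obtained from `inf_{n ≥ k} Fₙ` by truncating at height `k` and taking the largest `k`-Lipschitz
minorant are bounded and continuous, lie below `Fₙ` for `n ≥ k`, and increase to a limit above `f`;
so narrow convergence applies to each `Eₖ` and monotone convergence to their supremum.

It remains to see that the integrands are jointly lower semicontinuous in the law and the curve.
The mass of an atom is upper semicontinuous in the measure and the point, hence becomes lower
semicontinuous under a non-increasing lower semicontinuous weight. For the Lagrangian, convergence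
in `W^{1,q}` gives, along a subsequence, convergence of the derivatives almost everywhere, and the
classical Fatou lemma in time concludes.
-/

section SequentialLowerSemicontinuity

variable {X Y : Type*} [TopologicalSpace X] [TopologicalSpace Y] {f g : X → ℝ≥0∞}

theorem SeqLSC.comp_continuous (hf : SeqLSC f) {h : Y → X} (hh : Continuous h) :
    SeqLSC (fun y => f (h y)) :=
  fun _ y hu => hf _ _ ((hh.tendsto y).comp hu)

theorem SeqLSC.mul (hf : SeqLSC f) (hg : SeqLSC g) : SeqLSC (fun x => f x * g x) :=
  fun u x hu => (mul_le_mul' (hf u x hu) (hg u x hu)).trans ENNReal.le_liminf_mul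

theorem SeqLSC.add (hf : SeqLSC f) (hg : SeqLSC g) : SeqLSC (fun x => f x + g x) := by
  intro u x hu
  refine (add_le_add (hf u x hu) (hg u x hu)).trans ?_
  simp only [liminf_eq_iSup_iInf_of_nat]
  refine ENNReal.iSup_add_iSup_le fun i j => le_iSup_of_le (max i j) (le_iInf₂ fun n hn => ?_)
  exact add_le_add (iInf₂_le n ((le_max_left i j).trans hn))
    (iInf₂_le n ((le_max_right i j).trans hn))

theorem SeqLSC.of_lowerSemicontinuous (hf : LowerSemicontinuous f) : SeqLSC f :=
  fun _ x hu => (hf.le_liminf x).trans hu.liminf_le_liminf_comp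

theorem SeqLSC.of_exists_subseq
    (h : ∀ (u : ℕ → X) (x : X), Tendsto u atTop (𝓝 x) →
      ∃ s : ℕ → ℕ, Tendsto s atTop atTop ∧ f x ≤ liminf (fun k => f (u (s k))) atTop) :
    SeqLSC f := by
  intro u x hu
  obtain ⟨r, hr_lim, hr⟩ := exists_seq_tendsto_liminf (f := atTop) (u := fun n => f (u n))
  obtain ⟨s, hs, hle⟩ := h (u ∘ r) x (hu.comp hr)
  exact hle.trans_eq (hr_lim.comp hs).liminf_eq

end SequentialLowerSemicontinuity

section LipschitzEnvelope

variable {X : Type*} [PseudoEMetricSpace X] {f g : X → ℝ≥0∞} {k l : ℕ}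

/-- The Pasch–Hausdorff envelope of `f` truncated at height `k`, i.e. the largest `k`-Lipschitz
minorant of `min f k`. It approximates lower semicontinuous functions by bounded continuous ones,
which can be integrated along narrowly convergent measures. -/
noncomputable def lipschitzEnvelope (k : ℕ) (f : X → ℝ≥0∞) (x : X) : ℝ≥0∞ :=
  ⨅ y, min (f y) k + k * edist x y

theorem lipschitzEnvelope_le_min (k : ℕ) (f : X → ℝ≥0∞) (x : X) :
    lipschitzEnvelope k f x ≤ min (f x) k :=
  (iInf_le _ x).trans (by simp)

theorem lipschitzEnvelope_mono (hkl : k ≤ l) (hfg : f ≤ g) :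
    lipschitzEnvelope k f ≤ lipschitzEnvelope l g := by
  intro x
  have hkl' : (k : ℝ≥0∞) ≤ l := by exact_mod_cast hkl
  refine iInf_mono fun y => ?_
  gcongr
  exact hfg y

theorem continuous_lipschitzEnvelope (k : ℕ) (f : X → ℝ≥0∞) :
    Continuous (lipschitzEnvelope k f) := by
  refine continuous_of_le_add_edist k (ENNReal.natCast_ne_top k) fun x y => ?_
  simp only [lipschitzEnvelope, ENNReal.iInf_add]
  refine le_iInf fun z => (iInf_le _ z).trans ?_
  calc min (f z) k + k * edist x z
      ≤ min (f z) k + k * (edist y z + edist x y) := by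
        gcongr
        exact (edist_triangle x y z).trans_eq (add_comm _ _)
    _ = min (f z) k + k * edist y z + k * edist x y := by rw [mul_add, add_assoc]

theorem liminf_le_iSup_lipschitzEnvelope (F : ℕ → X → ℝ≥0∞) (x : X) :
    liminf (Function.uncurry F) (atTop ×ˢ 𝓝 x) ≤
      ⨆ k : ℕ, lipschitzEnvelope k (fun y => ⨅ n ≥ k, F n y) x := by
  refine le_of_forall_lt fun r hr => ?_
  obtain ⟨c, hrc, hc⟩ := exists_between hr
  obtain ⟨⟨N, ε⟩, ⟨-, hε⟩, hsub⟩ :=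
    (atTop_basis.prod Metric.nhds_basis_eball).eventually_iff.1 (eventually_lt_of_lt_liminf hc)
  have hlarge : ∀ n ≥ N, ∀ y, edist x y < ε → c < F n y := fun n hn y hy =>
    hsub (x := (n, y)) ⟨hn, by simpa [edist_comm] using hy⟩
  have hc_top : c ≠ ∞ := hc.ne_top
  obtain ⟨m₁, hm₁⟩ := ENNReal.exists_nat_gt hc_top
  obtain ⟨m₂, hm₂⟩ := ENNReal.exists_nat_mul_gt hε.ne' hc_top
  -- For `y` near `x` all `F n y` with `n ≥ N` exceed `c`; for the other `y` the penalty
  -- `k * edist x y` does.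
  refine hrc.trans_le (le_iSup_of_le (max N (max m₁ m₂)) (le_iInf fun y => ?_))
  set k := max N (max m₁ m₂)
  have hck : c ≤ k := hm₁.le.trans (by exact_mod_cast (by grind : m₁ ≤ k))
  rcases lt_or_ge (edist x y) ε with hy | hy
  · refine le_add_right (le_min (le_iInf₂ fun n hn => ?_) hck)
    exact (hlarge n ((le_max_left _ _).trans hn) y hy).le
  · refine le_add_left ?_
    calc c ≤ m₂ * ε := hm₂.le
      _ ≤ k * edist x y := by
        gcongr
        grind

end LipschitzEnvelope

section NarrowFatou

variable {X : Type*} [MeasurableSpace X]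

theorem continuous_lintegral_of_le_natCast [TopologicalSpace X] [OpensMeasurableSpace X]
    {g : X → ℝ≥0∞} (hg : Continuous g) {k : ℕ} (hgk : ∀ x, g x ≤ k) :
    Continuous fun η : ProbabilityMeasure X => ∫⁻ x, g x ∂(η : Measure X) := by
  have hne : ∀ x, g x ≠ ∞ := fun x => ne_top_of_le_ne_top (ENNReal.natCast_ne_top k) (hgk x)
  have hle : ∀ x, (g x).toNNReal ≤ k := fun x => by
    simpa using ENNReal.toNNReal_mono (ENNReal.natCast_ne_top k) (hgk x)
  let g' : BoundedContinuousFunction X ℝ≥0 :=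
    BoundedContinuousFunction.mkOfBound
      ⟨_, ENNReal.continuousOn_toNNReal.comp_continuous hg hne⟩ k fun x y => by
        rw [NNReal.dist_eq]
        exact abs_sub_le_of_nonneg_of_le (by positivity) (by exact_mod_cast hle x)
          (by positivity) (by exact_mod_cast hle y)
  have hg' : ∀ x, (g' x : ℝ≥0∞) = g x := fun x => ENNReal.coe_toNNReal (hne x)
  simpa only [hg'] using ProbabilityMeasure.continuous_lintegral_boundedContinuousFunction g'

variable [PseudoEMetricSpace X] [OpensMeasurableSpace X]

theorem lintegral_liminf_le_of_tendsto {ηs : ℕ → ProbabilityMeasure X} {η : ProbabilityMeasure X}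
    (hη : Tendsto ηs atTop (𝓝 η)) (F : ℕ → X → ℝ≥0∞) :
    ∫⁻ x, liminf (Function.uncurry F) (atTop ×ˢ 𝓝 x) ∂(η : Measure X) ≤
      liminf (fun n => ∫⁻ x, F n x ∂(ηs n : Measure X)) atTop := by
  set E : ℕ → X → ℝ≥0∞ := fun k => lipschitzEnvelope k (fun y => ⨅ n ≥ k, F n y)
  have hE_cont : ∀ k, Continuous (E k) := fun k => continuous_lipschitzEnvelope k _
  have hE_mono : Monotone E := fun k l hkl => lipschitzEnvelope_mono hkl fun y =>
    le_iInf₂ fun n hn => iInf₂_le n (hkl.trans hn)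
  have hE_le : ∀ k, ∀ n ≥ k, ∀ x, E k x ≤ F n x := fun k n hn x =>
    (lipschitzEnvelope_le_min k _ x).trans ((min_le_left _ _).trans (iInf₂_le n hn))
  have hE_lim : ∀ k, Tendsto (fun n => ∫⁻ x, E k x ∂(ηs n : Measure X)) atTop
      (𝓝 (∫⁻ x, E k x ∂(η : Measure X))) := fun k =>
    ((continuous_lintegral_of_le_natCast (hE_cont k) fun x =>
      (lipschitzEnvelope_le_min k _ x).trans (min_le_right _ _)).tendsto η).comp hη
  calc ∫⁻ x, liminf (Function.uncurry F) (atTop ×ˢ 𝓝 x) ∂(η : Measure X)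
      ≤ ∫⁻ x, ⨆ k, E k x ∂(η : Measure X) :=
        lintegral_mono fun x => liminf_le_iSup_lipschitzEnvelope F x
    _ = ⨆ k, ∫⁻ x, E k x ∂(η : Measure X) :=
        lintegral_iSup (fun k => (hE_cont k).measurable) hE_mono
    _ ≤ liminf (fun n => ∫⁻ x, F n x ∂(ηs n : Measure X)) atTop := iSup_le fun k => by
        rw [← (hE_lim k).liminf_eq]
        refine liminf_le_liminf ?_
        filter_upwards [eventually_ge_atTop k] with n hn
        exact lintegral_mono (hE_le k n hn)

theorem SeqLSC.lintegral {F : ProbabilityMeasure X → X → ℝ≥0∞}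
    (hF : SeqLSC (fun p : ProbabilityMeasure X × X => F p.1 p.2)) :
    SeqLSC (fun η : ProbabilityMeasure X => ∫⁻ x, F η x ∂(η : Measure X)) := by
  intro ηs η hη
  refine (lintegral_mono fun x => ?_).trans (lintegral_liminf_le_of_tendsto hη fun n => F (ηs n))
  obtain ⟨p, hp_lim, hp⟩ := exists_seq_tendsto_liminf (f := atTop ×ˢ 𝓝 x)
    (u := Function.uncurry fun n => F (ηs n))
  rw [← hp_lim.liminf_eq]
  exact hF (fun k => (ηs (p k).1, (p k).2)) (η, x)
    ((hη.comp hp.fst).prodMk_nhds hp.snd)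

end NarrowFatou

section AtomMass

theorem upperSemicontinuous_measureReal_singleton {X : Type*} [MetricSpace X] [MeasurableSpace X]
    [OpensMeasurableSpace X] :
    UpperSemicontinuous fun p : ProbabilityMeasure X × X => (p.1 : Measure X).real {p.2} := by
  rintro ⟨μ, x⟩ s hs
  have hthick : Tendsto (fun r : ℝ => (μ : Measure X) (Metric.cthickening r {x})) (𝓝[>] 0)
      (𝓝 ((μ : Measure X) {x})) :=
    (tendsto_measure_cthickening_of_isClosed ⟨1, one_pos, measure_ne_top _ _⟩
      isClosed_singleton).mono_left nhdsWithin_le_nhds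
  have hs' : (μ : Measure X) {x} < ENNReal.ofReal s :=
    (ENNReal.lt_ofReal_iff_toReal_lt (measure_ne_top _ _)).2 hs
  obtain ⟨r, hr_lt, hr : 0 < r⟩ :=
    ((hthick.eventually_lt_const hs').and self_mem_nhdsWithin).exists
  have hball : ∀ᶠ ν : ProbabilityMeasure X in 𝓝 μ,
      (ν : Measure X) (Metric.cthickening r {x}) < ENNReal.ofReal s :=
    eventually_lt_of_limsup_lt ((ProbabilityMeasure.limsup_measure_closed_le_of_tendsto
      tendsto_id Metric.isClosed_cthickening).trans_lt hr_lt)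
  rw [nhds_prod_eq]
  filter_upwards [hball.prod_mk (Metric.ball_mem_nhds x hr)] with ⟨ν, y⟩ ⟨hν, hy⟩
  refine (ENNReal.lt_ofReal_iff_toReal_lt (measure_ne_top _ _)).1 ((measure_mono ?_).trans_lt hν)
  exact singleton_subset_iff.2 (Metric.mem_cthickening_of_dist_le y x r {x} rfl (le_of_lt hy))

theorem lowerSemicontinuous_comp_of_antitone {X α β : Type*} [TopologicalSpace X] [LinearOrder α]
    [TopologicalSpace α] [OrderTopology α] [Preorder β] {g : α → β} (hg : Antitone g)
    (hg_lsc : LowerSemicontinuous g) {f : X → α} (hf : UpperSemicontinuous f) :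
    LowerSemicontinuous (g ∘ f) := by
  intro x c hc
  by_cases hmax : IsMax (f x)
  · refine Eventually.of_forall fun y => hc.trans_le (hg ?_)
    exact (le_total (f x) (f y)).elim (fun h => hmax h) id
  · obtain ⟨u, hu, hsub⟩ := exists_Ico_subset_of_mem_nhds (hg_lsc (f x) c hc) (not_isMax_iff.1 hmax)
    filter_upwards [hf x u hu] with y hy
    rcases le_total (f y) (f x) with hyx | hyx
    · exact hc.trans_le (hg hyx)
    · exact hsub ⟨hyx, hy⟩

/-- The mass of the atom of `μ` at `x`, with values in `[0, 1]`, where weights are defined. The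
multiplicity `multAt t y η` is the atom mass at `y` of the marginal of `η` at time `t`. -/
noncomputable def atomMass {X : Type*} [MeasurableSpace X] (μ : ProbabilityMeasure X) (x : X) : I :=
  ⟨(μ : Measure X).real {x}, measureReal_nonneg, measureReal_le_one⟩

theorem IsWeight.lowerSemicontinuous_atomMass {X : Type*} [MetricSpace X] [MeasurableSpace X]
    [OpensMeasurableSpace X] {ψ : I → ℝ≥0∞} (hψ : IsWeight ψ) :
    LowerSemicontinuous fun p : ProbabilityMeasure X × X => ψ (atomMass p.1 p.2) :=
  lowerSemicontinuous_comp_of_antitone hψ.anti hψ.lsc fun p s hs =>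
    upperSemicontinuous_measureReal_singleton p s hs

end AtomMass

section Marginals

variable {a b : ℝ} {d : ℕ}

theorem continuous_marginal (t : Icc a b) :
    Continuous (marginal t : ProbabilityMeasure (PathSpace a b d) → ProbabilityMeasure (Eucl d)) :=
  ProbabilityMeasure.continuous_map (continuous_eval_const t)

theorem continuous_map_of_forall_continuous {T Ω Y : Type*} [TopologicalSpace T]
    [FirstCountableTopology T] [MeasurableSpace Ω] [TopologicalSpace Y] [MeasurableSpace Y]
    [OpensMeasurableSpace Y] (η : ProbabilityMeasure Ω)
    {f : T → Ω → Y} (hf : ∀ t, Measurable (f t)) (hf_cont : ∀ ω, Continuous fun t => f t ω) :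
    Continuous fun t => η.map (hf t).aemeasurable := by
  rw [ProbabilityMeasure.continuous_iff_forall_continuous_integral]
  intro g
  have hg : ∀ t, ∫ y, g y ∂(η.map (hf t).aemeasurable : Measure Y) =
      ∫ ω, g (f t ω) ∂(η : Measure Ω) := fun t =>
    integral_map (hf t).aemeasurable g.continuous.measurable.aestronglyMeasurable
  simp only [hg]
  refine continuous_of_dominated (bound := fun _ => ‖g‖) (fun t => ?_) (fun t => ?_)
    (integrable_const _) ?_
  · exact (g.continuous.measurable.comp (hf t)).aestronglyMeasurable
  · exact Eventually.of_forall fun ω => g.norm_coe_le_norm _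
  · exact Eventually.of_forall fun ω => g.continuous.comp (hf_cont ω)

theorem continuous_marginal_time (η : ProbabilityMeasure (PathSpace a b d)) :
    Continuous fun t : Icc a b => marginal t η :=
  continuous_map_of_forall_continuous η measurable_ev ContinuousMap.continuous

theorem multAt_eq_atomMass (t : Icc a b) (y : Eucl d) (η : ProbabilityMeasure (PathSpace a b d)) :
    multAt t y η = atomMass (marginal t η) y := by
  refine Subtype.ext ?_
  simp only [multAt, atomMass, marginal, ProbabilityMeasure.toMeasure_map]
  rw [map_measureReal_apply (measurable_ev t) (measurableSet_singleton y)]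
  rfl

theorem IsWeight.seqLSC_multAt {ψ : I → ℝ≥0∞} (hψ : IsWeight ψ) (t : Icc a b) :
    SeqLSC fun p : ProbabilityMeasure (PathSpace a b d) × Eucl d => ψ (multAt t p.2 p.1) := by
  simp only [multAt_eq_atomMass]
  exact .of_lowerSemicontinuous (hψ.lowerSemicontinuous_atomMass.comp
    ((continuous_marginal t).prodMap continuous_id))

theorem IsWeight.measurable_multAt {ψ : I → ℝ≥0∞} (hψ : IsWeight ψ)
    (η : ProbabilityMeasure (PathSpace a b d)) :
    Measurable fun p : PathSpace a b d × Icc a b => ψ (multAt p.2 (p.1 p.2) η) := by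
  simp only [multAt_eq_atomMass]
  have hcont : Continuous fun p : PathSpace a b d × Icc a b => (marginal p.2 η, p.1 p.2) :=
    ((continuous_marginal_time η).comp continuous_snd).prodMk (by fun_prop)
  exact (hψ.lowerSemicontinuous_atomMass.comp hcont).measurable

end Marginals

section TerminalCost

variable {a b : ℝ} {d : ℕ}

theorem seqLSC_terminalCost (hab : a ≤ b) {φ : I → ℝ≥0∞} (hφ : IsWeight φ)
    {G : Eucl d → ProbabilityMeasure (Eucl d) → ℝ≥0∞}
    (hG : SeqLSC fun p : Eucl d × ProbabilityMeasure (Eucl d) => G p.1 p.2) :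
    SeqLSC (terminalCost hab φ G) := by
  set T : Icc a b := ⟨b, right_mem_Icc.2 hab⟩
  have hev : Continuous fun p : ProbabilityMeasure (PathSpace a b d) × PathSpace a b d => p.2 T :=
    (continuous_eval_const T).comp continuous_snd
  have hweight := (hφ.seqLSC_multAt T).comp_continuous (continuous_fst.prodMk hev)
  have hcost := hG.comp_continuous (hev.prodMk ((continuous_marginal T).comp continuous_fst))
  exact (hweight.mul hcost).lintegral

end TerminalCost

section LebesgueMeasure

variable {a b : ℝ}

theorem leb_apply (s : Set (Icc a b)) : leb a b s = volume (Subtype.val '' s) :=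
  (MeasurableEmbedding.subtype_coe measurableSet_Icc).comap_apply _ _

instance isFiniteMeasure_leb : IsFiniteMeasure (leb a b) := by
  refine ⟨?_⟩
  rw [leb_apply, image_univ, Subtype.range_val]
  exact measure_Icc_lt_top

theorem ae_leb_mem_Ioo : ∀ᵐ t : Icc a b ∂(leb a b), (t : ℝ) ∈ Ioo a b := by
  rw [ae_iff, leb_apply]
  refine measure_mono_null ?_ ((toFinite {a, b}).measure_zero volume)
  rintro _ ⟨t, ht, rfl⟩
  by_contra hne
  simp only [mem_insert_iff, mem_singleton_iff, not_or] at hne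
  exact ht ⟨lt_of_le_of_ne t.2.1 (Ne.symm hne.1), lt_of_le_of_ne t.2.2 hne.2⟩

end LebesgueMeasure

section Measurability

theorem IsBorelFun.measurable_comp {X Y Z : Type*} [TopologicalSpace X] [TopologicalSpace Y]
    [TopologicalSpace Z] [MeasurableSpace X] [OpensMeasurableSpace X] [MeasurableSpace Z]
    [BorelSpace Z] {f : Y → Z} (hf : IsBorelFun f) {g : X → Y} (hg : Continuous g) :
    Measurable fun x => f (g x) := by
  borelize Y
  have hf' : Measurable f := by
    rw [BorelSpace.measurable_eq (α := Z)]
    exact hf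
  exact hf'.comp hg.measurable

variable {a b : ℝ} {d : ℕ}

theorem evDot_eq_deriv_projIcc (hab : a ≤ b) {t : Icc a b} (ht : (t : ℝ) ∈ Ioo a b)
    (γ : PathSpace a b d) : evDot t γ = deriv (fun s => γ (projIcc a b hab s)) t := by
  have hext : EqOn (onReal γ) (fun s => γ (projIcc a b hab s)) (Icc a b) := fun s hs => by
    simp only [onReal, projIcc_of_mem hab hs]
    exact Subtype.val_injective.extend_apply γ 0 ⟨s, hs⟩
  rw [evDot, derivWithin_congr hext (hext t.2), derivWithin_of_mem_nhds (Icc_mem_nhds ht.1 ht.2)]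

theorem exists_measurable_evDot_ae_eq : ∃ D : PathSpace a b d × Icc a b → Eucl d,
    Measurable D ∧ ∀ᵐ t ∂(leb a b), ∀ γ, evDot t γ = D (γ, t) := by
  rcases le_or_gt a b with hab | hba
  · refine ⟨fun p => deriv (fun s => p.1 (projIcc a b hab s)) p.2, ?_, ?_⟩
    · have hcont : Continuous (Function.uncurry fun (γ : PathSpace a b d) (s : ℝ) =>
          γ (projIcc a b hab s)) := by
        have := continuous_projIcc (h := hab)
        simp only [Function.uncurry_def]
        fun_prop
      exact (measurable_deriv_with_param hcont).comp (measurable_id.prodMap measurable_subtype_coe)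
    · filter_upwards [ae_leb_mem_Ioo] with t ht γ
      exact evDot_eq_deriv_projIcc hab ht γ
  · have : IsEmpty (Icc a b) := isEmpty_coe_sort.2 (Icc_eq_empty hba.not_ge)
    exact ⟨0, measurable_zero, .of_forall isEmptyElim⟩

end Measurability

section PathCost

variable {a b : ℝ} {d : ℕ} {ψ : I → ℝ≥0∞}
  {L : Icc a b → Eucl d → Eucl d → ProbabilityMeasure (Eucl d) → ℝ≥0∞}

/-- The running cost at time `t` of the curve `γ`, when the population of curves has law `η`. -/
noncomputable def runningIntegrand (ψ : I → ℝ≥0∞)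
    (L : Icc a b → Eucl d → Eucl d → ProbabilityMeasure (Eucl d) → ℝ≥0∞)
    (η : ProbabilityMeasure (PathSpace a b d)) (γ : PathSpace a b d) (t : Icc a b) : ℝ≥0∞ :=
  ψ (multAt t (γ t) η) * L t (γ t) (evDot t γ) (marginal t η)

/-- The running cost of the single curve `γ`, when the population of curves has law `η`. The
functional `runningCost ψ L` is its average over curves drawn from `η` itself. -/
noncomputable def pathCost (ψ : I → ℝ≥0∞)
    (L : Icc a b → Eucl d → Eucl d → ProbabilityMeasure (Eucl d) → ℝ≥0∞)
    (η : ProbabilityMeasure (PathSpace a b d)) (γ : PathSpace a b d) : ℝ≥0∞ :=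
  ∫⁻ t, runningIntegrand ψ L η γ t ∂(leb a b)

theorem exists_measurable_runningIntegrand_ae_eq (hψ : IsWeight ψ)
    (hL : IsBorelFun (fun p : Icc a b × Eucl d × Eucl d × ProbabilityMeasure (Eucl d) =>
      L p.1 p.2.1 p.2.2.1 p.2.2.2))
    (η : ProbabilityMeasure (PathSpace a b d)) :
    ∃ f : PathSpace a b d × Icc a b → ℝ≥0∞, Measurable f ∧
      ∀ᵐ t ∂(leb a b), ∀ γ, runningIntegrand ψ L η γ t = f (γ, t) := by
  obtain ⟨D, hD, hD_eq⟩ := exists_measurable_evDot_ae_eq (a := a) (b := b) (d := d)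
  have hL_marginal : Measurable fun p : Icc a b × Eucl d × Eucl d =>
      L p.1 p.2.1 p.2.2 (marginal p.1 η) :=
    hL.measurable_comp <| continuous_fst.prodMk <| continuous_snd.fst.prodMk <|
      continuous_snd.snd.prodMk ((continuous_marginal_time η).comp continuous_fst)
  have hev : Continuous fun p : PathSpace a b d × Icc a b => p.1 p.2 := by fun_prop
  refine ⟨_, (hψ.measurable_multAt η).mul
    (hL_marginal.comp (measurable_snd.prodMk (hev.measurable.prodMk hD))), ?_⟩
  filter_upwards [hD_eq] with t ht γ
  simp only [runningIntegrand, ht γ]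
  rfl

theorem aemeasurable_runningIntegrand (hψ : IsWeight ψ)
    (hL : IsBorelFun (fun p : Icc a b × Eucl d × Eucl d × ProbabilityMeasure (Eucl d) =>
      L p.1 p.2.1 p.2.2.1 p.2.2.2))
    (η : ProbabilityMeasure (PathSpace a b d)) (γ : PathSpace a b d) :
    AEMeasurable (runningIntegrand ψ L η γ) (leb a b) := by
  obtain ⟨f, hf, hf_eq⟩ := exists_measurable_runningIntegrand_ae_eq hψ hL η
  exact ⟨fun t => f (γ, t), hf.comp measurable_prodMk_left, hf_eq.mono fun t ht => ht γ⟩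

theorem measurable_pathCost (hψ : IsWeight ψ)
    (hL : IsBorelFun (fun p : Icc a b × Eucl d × Eucl d × ProbabilityMeasure (Eucl d) =>
      L p.1 p.2.1 p.2.2.1 p.2.2.2))
    (η : ProbabilityMeasure (PathSpace a b d)) : Measurable (pathCost ψ L η) := by
  obtain ⟨f, hf, hf_eq⟩ := exists_measurable_runningIntegrand_ae_eq hψ hL η
  have hcost : pathCost ψ L η = fun γ => ∫⁻ t, f (γ, t) ∂(leb a b) :=
    funext fun γ => lintegral_congr_ae (hf_eq.mono fun t ht => ht γ)
  rw [hcost]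
  exact hf.lintegral_prod_right'

theorem pathCost_le_liminf_of_ae_tendsto (hψ : IsWeight ψ)
    (hL_borel : IsBorelFun (fun p : Icc a b × Eucl d × Eucl d × ProbabilityMeasure (Eucl d) =>
      L p.1 p.2.1 p.2.2.1 p.2.2.2))
    (hL_lsc : ∀ᵐ t ∂(leb a b), SeqLSC
      (fun p : Eucl d × Eucl d × ProbabilityMeasure (Eucl d) => L t p.1 p.2.1 p.2.2))
    {ηs : ℕ → ProbabilityMeasure (PathSpace a b d)} {η : ProbabilityMeasure (PathSpace a b d)}
    (hη : Tendsto ηs atTop (𝓝 η)) {γs : ℕ → PathSpace a b d} {γ : PathSpace a b d}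
    (hγ : Tendsto γs atTop (𝓝 γ))
    (hγ_dot : ∀ᵐ t ∂(leb a b), Tendsto (fun n => evDot t (γs n)) atTop (𝓝 (evDot t γ))) :
    pathCost ψ L η γ ≤ liminf (fun n => pathCost ψ L (ηs n) (γs n)) atTop := by
  have hintegrand : ∀ᵐ t ∂(leb a b), runningIntegrand ψ L η γ t ≤
      liminf (fun n => runningIntegrand ψ L (ηs n) (γs n) t) atTop := by
    filter_upwards [hL_lsc, hγ_dot] with t hLt hdot
    have hev : Tendsto (fun n => γs n t) atTop (𝓝 (γ t)) :=
      ((continuous_eval_const t).tendsto γ).comp hγ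
    have hmarg : Tendsto (fun n => marginal t (ηs n)) atTop (𝓝 (marginal t η)) :=
      ((continuous_marginal t).tendsto η).comp hη
    refine le_trans (mul_le_mul' ?_ ?_) ENNReal.le_liminf_mul
    · exact hψ.seqLSC_multAt t (fun n => (ηs n, γs n t)) (η, γ t) (hη.prodMk_nhds hev)
    · exact hLt (fun n => (γs n t, evDot t (γs n), marginal t (ηs n)))
        (γ t, evDot t γ, marginal t η) (hev.prodMk_nhds (hdot.prodMk_nhds hmarg))
  calc pathCost ψ L η γ
      ≤ ∫⁻ t, liminf (fun n => runningIntegrand ψ L (ηs n) (γs n) t) atTop ∂(leb a b) :=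
        lintegral_mono_ae hintegrand
    _ ≤ liminf (fun n => pathCost ψ L (ηs n) (γs n)) atTop :=
        lintegral_liminf_le' fun n => aemeasurable_runningIntegrand hψ hL_borel (ηs n) (γs n)

end PathCost

namespace SobolevPath

variable {a b : ℝ} {d : ℕ} {q : ℝ≥0∞} [Fact (1 ≤ q)] {ψ : I → ℝ≥0∞}
  {L : Icc a b → Eucl d → Eucl d → ProbabilityMeasure (Eucl d) → ℝ≥0∞}

theorem continuous_graphMap :
    Continuous (graphMap : SobolevPath a b d q → PathSpace a b d × Lp (Eucl d) q (leb a b)) :=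
  continuous_induced_dom

theorem continuous_toPath : Continuous (toPath : SobolevPath a b d q → PathSpace a b d) :=
  continuous_fst.comp continuous_graphMap

theorem continuous_derivLp :
    Continuous (derivLp : SobolevPath a b d q → Lp (Eucl d) q (leb a b)) :=
  continuous_snd.comp continuous_graphMap

theorem continuous_lawOnPaths :
    Continuous (lawOnPaths : ProbabilityMeasure (SobolevPath a b d q) → _) :=
  ProbabilityMeasure.continuous_map continuous_toPath

theorem exists_subseq_ae_tendsto_evDot {γs : ℕ → SobolevPath a b d q} {γ : SobolevPath a b d q}
    (hγ : Tendsto γs atTop (𝓝 γ)) :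
    ∃ s : ℕ → ℕ, StrictMono s ∧ ∀ᵐ t ∂(leb a b),
      Tendsto (fun k => evDot t (γs (s k)).toPath) atTop (𝓝 (evDot t γ.toPath)) := by
  have hderiv : Tendsto (fun n => (γs n).derivLp) atTop (𝓝 γ.derivLp) :=
    (continuous_derivLp.tendsto γ).comp hγ
  obtain ⟨s, hs, hae⟩ := (tendstoInMeasure_of_tendsto_Lp hderiv).exists_seq_tendsto_ae
  have hcoe : ∀ γ : SobolevPath a b d q, ∀ᵐ t ∂(leb a b), γ.derivLp t = evDot t γ.toPath :=
    fun γ => γ.2.2.coeFn_toLp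
  refine ⟨s, hs, ?_⟩
  filter_upwards [hae, ae_all_iff.2 fun n => hcoe (γs n), hcoe γ] with t ht hn h
  simpa only [hn, h] using ht

theorem seqLSC_pathCost (hψ : IsWeight ψ)
    (hL_borel : IsBorelFun (fun p : Icc a b × Eucl d × Eucl d × ProbabilityMeasure (Eucl d) =>
      L p.1 p.2.1 p.2.2.1 p.2.2.2))
    (hL_lsc : ∀ᵐ t ∂(leb a b), SeqLSC
      (fun p : Eucl d × Eucl d × ProbabilityMeasure (Eucl d) => L t p.1 p.2.1 p.2.2)) :
    SeqLSC fun p : ProbabilityMeasure (PathSpace a b d) × SobolevPath a b d q =>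
      pathCost ψ L p.1 p.2.toPath := by
  refine .of_exists_subseq fun u p hu => ?_
  obtain ⟨s, hs, hdot⟩ := exists_subseq_ae_tendsto_evDot hu.snd_nhds
  have hus : Tendsto (fun k => u (s k)) atTop (𝓝 p) := hu.comp hs.tendsto_atTop
  exact ⟨s, hs.tendsto_atTop, pathCost_le_liminf_of_ae_tendsto hψ hL_borel hL_lsc hus.fst_nhds
    ((continuous_toPath.tendsto p.2).comp hus.snd_nhds) hdot⟩

theorem runningCost_lawOnPaths (hψ : IsWeight ψ)
    (hL : IsBorelFun (fun p : Icc a b × Eucl d × Eucl d × ProbabilityMeasure (Eucl d) =>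
      L p.1 p.2.1 p.2.2.1 p.2.2.2))
    (η : ProbabilityMeasure (SobolevPath a b d q)) :
    runningCost ψ L (lawOnPaths η) =
      ∫⁻ γ, pathCost ψ L (lawOnPaths η) γ.toPath ∂(η : Measure (SobolevPath a b d q)) :=
  lintegral_map (measurable_pathCost hψ hL _) measurable_toPath

theorem seqLSC_runningCost (hψ : IsWeight ψ)
    (hL_borel : IsBorelFun (fun p : Icc a b × Eucl d × Eucl d × ProbabilityMeasure (Eucl d) =>
      L p.1 p.2.1 p.2.2.1 p.2.2.2))
    (hL_lsc : ∀ᵐ t ∂(leb a b), SeqLSC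
      (fun p : Eucl d × Eucl d × ProbabilityMeasure (Eucl d) => L t p.1 p.2.1 p.2.2)) :
    SeqLSC fun η : ProbabilityMeasure (SobolevPath a b d q) => runningCost ψ L (lawOnPaths η) := by
  simp only [runningCost_lawOnPaths hψ hL_borel]
  have hlaw : Continuous fun p : ProbabilityMeasure (SobolevPath a b d q) × SobolevPath a b d q =>
      (lawOnPaths p.1, p.2) := continuous_lawOnPaths.prodMap continuous_id
  exact ((seqLSC_pathCost hψ hL_borel hL_lsc).comp_continuous hlaw).lintegral

end SobolevPath

theorem mainTheorem4_general (a b : ℝ) (hab : a ≤ b) (d : ℕ) (q : ℝ≥0∞) [Fact (1 ≤ q)]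
    (L : Icc a b → Eucl d → Eucl d → ProbabilityMeasure (Eucl d) → ℝ≥0∞)
    (hL_borel : IsBorelFun (fun p : Icc a b × Eucl d × Eucl d × ProbabilityMeasure (Eucl d) =>
      L p.1 p.2.1 p.2.2.1 p.2.2.2))
    (hL_lsc : ∀ᵐ t ∂(leb a b), SeqLSC
      (fun p : Eucl d × Eucl d × ProbabilityMeasure (Eucl d) => L t p.1 p.2.1 p.2.2))
    (G : Eucl d → ProbabilityMeasure (Eucl d) → ℝ≥0∞)
    (hG : SeqLSC (fun p : Eucl d × ProbabilityMeasure (Eucl d) => G p.1 p.2))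
    (ψ φ : I → ℝ≥0∞) (hψ : IsWeight ψ) (hφ : IsWeight φ) :
    SeqLSC (fun η : ProbabilityMeasure (SobolevPath a b d q) =>
      totalCost hab ψ φ L G (SobolevPath.lawOnPaths η)) :=
  (SobolevPath.seqLSC_runningCost hψ hL_borel hL_lsc).add
    ((seqLSC_terminalCost hab hφ hG).comp_continuous SobolevPath.continuous_lawOnPaths)

theorem mainTheorem4 (a b : ℝ) (hab : a ≤ b) (d : ℕ) (q : ℝ≥0∞) [Fact (1 ≤ q)] (hq : q ≠ ∞)
    (L : Icc a b → Eucl d → Eucl d → ProbabilityMeasure (Eucl d) → ℝ≥0∞) (hL : IsLagrangian L)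
    (G : Eucl d → ProbabilityMeasure (Eucl d) → ℝ≥0∞) (hG : IsTerminalCost G)
    (ψ φ : I → ℝ≥0∞) (hψ : IsWeight ψ) (hφ : IsWeight φ) :
    SeqLSC (fun η : ProbabilityMeasure (SobolevPath a b d q) =>
      totalCost hab ψ φ L G (SobolevPath.lawOnPaths η)) :=
  mainTheorem4_general a b hab d q L hL.borel hL.lsc G hG.lsc ψ φ hψ hφ
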